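/- Let $\mathcal R$ denote Riemann's auxiliary function, the entire function $$\mathcal R(s)=\int_{0\swarrow 1}\frac{x^{-s}e^{\pi i x^2}}{e^{\pi i x}-e^{-\pi i x}}\,dx\qquad(s\in\mathbb C),$$ where $x^{-s}=e^{-s\log x}$ with the principal branch of the logarithm, and the path of integration $0\swarrow1$ is the straight line $\{\tfrac12+ue^{\pi i/4}:u\in\mathbb R\}$, which crosses the real axis between $0$ and $1$, traversed from the upper right to the lower left. Then for all real $\sigma>0$ and $t>16\pi$, $$|\mathcal R(\sigma+it)|\le 2\sqrt{\frac{t}{2\pi}}.$$ -/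

import Mathlib

/-- The integrand `x ^ (-s) * exp (π i x²) / (exp (π i x) - exp (-π i x))` of Riemann's auxiliary
function, with the principal branch of `x ^ (-s)` (cut along the non-positive real axis). -/
noncomputable def auxIntegrand (s x : ℂ) : ℂ :=
  x ^ (-s) * Complex.exp (Real.pi * Complex.I * x ^ 2) /
    (Complex.exp (Real.pi * Complex.I * x) - Complex.exp (-(Real.pi * Complex.I * x)))

/-- The straight line of direction `exp (π i / 4)` that meets the real axis at `1 / 2`,
parametrized from the lower left to the upper right. It avoids the branch cut and the integers. -/
noncomputable def auxLine (u : ℝ) : ℂ :=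
  1 / 2 + u * Complex.exp (Real.pi * Complex.I / 4)

/-- Riemann's auxiliary function `R(s) = ∫_{0 ↙ 1} x^(-s) e^(π i x²) / (e^(π i x) - e^(-π i x)) dx`.
The path comes from infinity at the upper right and goes to infinity at the lower left, opposite to
`auxLine`, hence the minus sign. The integral converges absolutely for every `s`. -/
noncomputable def riemannAux (s : ℂ) : ℂ :=
  -∫ u : ℝ, auxIntegrand s (auxLine u) * Complex.exp (Real.pi * Complex.I / 4)

open Complex MeasureTheory Filter Topology

/-! Put `a = √(t / 2π)`, the positive saddle point of `x ^ (-i t) * exp (π i x²)`, and `N = ⌊a⌋`.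
Moving the path from `1/2` to `b = N + 1/2`, within `1/2` of the saddle, crosses the poles `1, …, N`
and splits off `∑ n ^ (-s)`, of norm at most `N` (`riemannAux_eq_sum_sub_integral`,
`norm_riemannAux_le`).

On the new line the denominator has norm at least `2`, `|x| ^ (-σ) ≤ 1`, and `arg x ≤ im x / b` when
`re x ≥ 0`. The integrand is thus dominated by Gaussians, with integral at most `(exp (π κ² / 2) +
exp (-π² a²)) / 2`, where `κ = (a² - b²) / b` (`integral_norm_auxIntegrand_le`). As `b` is close to
`a`, this is at most `2a - N` (`exp_add_exp_le_of_floor`), and the total is `2a`. -/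

/-! ### The denominator and the oblique lines. -/

/-- The denominator `exp (π i x) - exp (-π i x) = 2 i sin (π x)` of `auxIntegrand`. -/
noncomputable def auxDenom (x : ℂ) : ℂ :=
  cexp (Real.pi * I * x) - cexp (-(Real.pi * I * x))

/-- The line of direction `exp (π i / 4)` that meets the real axis at `b`. -/
noncomputable def obliqueLine (b u : ℝ) : ℂ := b + u * cexp (Real.pi * I / 4)

theorem exp_pi_I_div_four :
    cexp (Real.pi * I / 4) = ((√2 / 2 : ℝ) : ℂ) + ((√2 / 2 : ℝ) : ℂ) * I := by
  rw [show (Real.pi * I / 4 : ℂ) = ((Real.pi / 4 : ℝ) : ℂ) * I by push_cast; ring, exp_mul_I,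
    ← ofReal_cos, ← ofReal_sin, Real.cos_pi_div_four, Real.sin_pi_div_four]

theorem exp_pi_I_div_four_sq : cexp (Real.pi * I / 4) ^ 2 = I := by
  rw [← Complex.exp_nat_mul,
    show ((2 : ℕ) : ℂ) * (Real.pi * I / 4) = (Real.pi / 2 : ℂ) * I by push_cast; ring,
    exp_pi_div_two_mul_I]

theorem norm_exp_pi_I_div_four : ‖cexp (Real.pi * I / 4)‖ = 1 := by
  rw [show (Real.pi * I / 4 : ℂ) = ((Real.pi / 4 : ℝ) : ℂ) * I by push_cast; ring,
    norm_exp_ofReal_mul_I]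

theorem obliqueLine_re (b u : ℝ) : (obliqueLine b u).re = b + u * (√2 / 2) := by
  simp [obliqueLine, exp_pi_I_div_four]

theorem obliqueLine_im (b u : ℝ) : (obliqueLine b u).im = u * (√2 / 2) := by
  simp [obliqueLine, exp_pi_I_div_four]

theorem continuous_obliqueLine (b : ℝ) : Continuous (obliqueLine b) := by
  unfold obliqueLine; fun_prop

theorem auxDenom_eq (x : ℂ) : auxDenom x = 2 * I * Complex.sin (Real.pi * x) := by
  rw [auxDenom, Complex.sin,
    show -(Real.pi * x : ℂ) * I = -(Real.pi * I * x) by ring,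
    show (Real.pi * x : ℂ) * I = Real.pi * I * x by ring]
  linear_combination (cexp (Real.pi * I * x) - cexp (-(Real.pi * I * x))) * I_sq

theorem norm_auxDenom_sq (x : ℂ) :
    ‖auxDenom x‖ ^ 2 =
      4 * (Real.sin (Real.pi * x.re) ^ 2 + Real.sinh (Real.pi * x.im) ^ 2) := by
  have h : (Real.pi * x : ℂ) = ((Real.pi * x.re : ℝ) : ℂ) + ((Real.pi * x.im : ℝ) : ℂ) * I := by
    conv_lhs => rw [← re_add_im x]
    push_cast; ring
  rw [auxDenom_eq, h, Complex.sin_add_mul_I, ← ofReal_sin, ← ofReal_cos, ← ofReal_cosh,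
    ← ofReal_sinh, ← ofReal_mul, ← ofReal_mul, norm_mul, mul_pow, norm_mul, norm_I,
    Complex.sq_norm (_ + _), normSq_add_mul_I]
  have h1 := Real.sin_sq_add_cos_sq (Real.pi * x.re)
  have h2 := Real.cosh_sq (Real.pi * x.im)
  simp only [Complex.norm_ofNat, mul_pow, h2]
  linear_combination 4 * Real.sinh (Real.pi * x.im) ^ 2 * h1

theorem sq_le_sinh_sq (y : ℝ) : y ^ 2 ≤ Real.sinh y ^ 2 := by
  rw [sq_le_sq]
  rcases le_total 0 y with h | h
  · rw [abs_of_nonneg h, abs_of_nonneg (Real.sinh_nonneg_iff.2 h)]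
    exact Real.self_le_sinh_iff.2 h
  · rw [abs_of_nonpos h, abs_of_nonpos (Real.sinh_nonpos_iff.2 h)]
    exact neg_le_neg (Real.sinh_le_self_iff.2 h)

theorem two_le_norm_auxDenom_of_im {x : ℂ} (hx : 1 ≤ |x.im|) : 2 ≤ ‖auxDenom x‖ := by
  refine (pow_le_pow_iff_left₀ zero_le_two (norm_nonneg _) two_ne_zero).1 ?_
  have h := sq_le_sinh_sq (Real.pi * x.im)
  have h1 : 1 ≤ x.im ^ 2 := by rw [← sq_abs]; nlinarith
  have h2 : (1 : ℝ) ≤ (Real.pi * x.im) ^ 2 := by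
    rw [mul_pow]; nlinarith [Real.pi_gt_three]
  rw [norm_auxDenom_sq]
  nlinarith [sq_nonneg (Real.sin (Real.pi * x.re))]

/-- At half-integers `sin²` turns into `cos² w` with the same `w` as in `sinh² w`, and `sinh² w ≥ w²
≥ sin² w`. -/
theorem two_le_norm_auxDenom_obliqueLine (k : ℕ) (u : ℝ) :
    2 ≤ ‖auxDenom (obliqueLine (k + 1 / 2) u)‖ := by
  refine (pow_le_pow_iff_left₀ zero_le_two (norm_nonneg _) two_ne_zero).1 ?_
  rw [norm_auxDenom_sq, obliqueLine_re, obliqueLine_im]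
  set w := Real.pi * (u * (√2 / 2)) with hw
  have h1 : Real.sin (Real.pi * (k + 1 / 2 + u * (√2 / 2))) ^ 2 = Real.cos w ^ 2 := by
    rw [show Real.pi * (k + 1 / 2 + u * (√2 / 2)) = (w + Real.pi / 2) + k * Real.pi by
      rw [hw]; ring, Real.sin_add_nat_mul_pi, Real.sin_add_pi_div_two, mul_pow, ← pow_mul,
      mul_comm k 2, pow_mul]
    simp
  have h2 := sq_le_sinh_sq w
  have h3 : Real.sin w ^ 2 ≤ w ^ 2 := sq_le_sq.2 Real.abs_sin_le_abs
  rw [h1]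
  nlinarith [Real.sin_sq_add_cos_sq w]

theorem auxDenom_add_one (x : ℂ) : auxDenom (x + 1) = -auxDenom x := by
  rw [auxDenom_eq, auxDenom_eq, mul_add, mul_one, Complex.sin_add_pi]; ring

theorem exists_int_of_auxDenom_eq_zero {x : ℂ} (hx : auxDenom x = 0) : ∃ m : ℤ, x = m := by
  rw [auxDenom_eq] at hx
  have h : Complex.sin (Real.pi * x) = 0 := by simpa using hx
  obtain ⟨m, hm⟩ := Complex.sin_eq_zero_iff.1 h
  refine ⟨m, mul_left_cancel₀ (ofReal_ne_zero.2 Real.pi_ne_zero) (hm.trans (mul_comm _ _))⟩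

theorem auxDenom_natCast (n : ℕ) : auxDenom n = 0 := by
  rw [auxDenom_eq, mul_comm (Real.pi : ℂ), Complex.sin_nat_mul_pi, mul_zero]

theorem hasDerivAt_auxDenom (x : ℂ) :
    HasDerivAt auxDenom (2 * I * (Complex.cos (Real.pi * x) * Real.pi)) x := by
  have h : auxDenom = fun x => 2 * I * Complex.sin (Real.pi * x) := funext auxDenom_eq
  rw [h]
  have h1 : HasDerivAt (fun x : ℂ => (Real.pi : ℂ) * x) Real.pi x := by
    simpa using (hasDerivAt_id x).const_mul (Real.pi : ℂ)
  exact h1.csin.const_mul _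

theorem deriv_auxDenom_natCast_ne_zero (n : ℕ) : deriv auxDenom n ≠ 0 := by
  rw [(hasDerivAt_auxDenom n).deriv]
  have h : Complex.cos (Real.pi * n) ≠ 0 := by
    intro h
    have h1 := Complex.sin_sq_add_cos_sq (Real.pi * n)
    rw [h, mul_comm (Real.pi : ℂ), Complex.sin_nat_mul_pi] at h1
    norm_num at h1
  simp [h, Real.pi_ne_zero]

/-! ### Modulus of the integrand. -/

theorem norm_exp_pi_I_mul_sq (x : ℂ) :
    ‖cexp (Real.pi * I * x ^ 2)‖ = Real.exp (-(2 * Real.pi * (x.re * x.im))) := by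
  rw [norm_exp]
  congr 1
  simp [sq]
  ring

theorem norm_cpow_neg {x : ℂ} (hx : x ≠ 0) (σ t : ℝ) :
    ‖x ^ (-((σ : ℂ) + t * I))‖ = ‖x‖ ^ (-σ) * Real.exp (t * arg x) := by
  rw [norm_cpow_of_ne_zero hx, div_eq_mul_inv, ← Real.exp_neg]
  congr 2
  · simp
  · simp [mul_comm]

theorem norm_auxIntegrand {x : ℂ} (hx : x ≠ 0) (σ t : ℝ) :
    ‖auxIntegrand (σ + t * I) x‖ =
      ‖x‖ ^ (-σ) * Real.exp (t * arg x - 2 * Real.pi * (x.re * x.im)) / ‖auxDenom x‖ := by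
  rw [auxIntegrand, norm_div, norm_mul, norm_cpow_neg hx, norm_exp_pi_I_mul_sq,
    sub_eq_add_neg (t * arg x), Real.exp_add, mul_assoc (_ ^ _), auxDenom]

/-! ### Cauchy's theorem in an oblique strip. -/

theorem exp_pi_I_div_four_mul_re (z : ℂ) :
    (cexp (Real.pi * I / 4) * z).re = (z.re - z.im) * (√2 / 2) := by
  rw [exp_pi_I_div_four]; simp; ring

theorem exp_pi_I_div_four_mul_im (z : ℂ) :
    (cexp (Real.pi * I / 4) * z).im = (z.re + z.im) * (√2 / 2) := by
  rw [exp_pi_I_div_four]; simp; ring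

theorem exp_pi_I_div_four_mul_eq_obliqueLine (b u : ℝ) :
    cexp (Real.pi * I / 4) * (u + (-(b * (√2 / 2)) : ℝ) * I) =
      obliqueLine b (u - b * (√2 / 2)) := by
  have h2 : √2 * √2 = 2 := Real.mul_self_sqrt zero_le_two
  apply Complex.ext
  · rw [exp_pi_I_div_four_mul_re, obliqueLine_re]
    simp
    linear_combination b / 2 * h2
  · rw [exp_pi_I_div_four_mul_im, obliqueLine_im]
    simp
    ring

/-- A holomorphic function on the closed oblique strip between two parallel lines has the same
integral along both, provided that it decays like `exp (π i x²)` in the strip. -/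
theorem integral_obliqueLine_eq {H : ℂ → ℂ} {b c C T : ℝ} (hbc : b ≤ c)
    (hd : DifferentiableOn ℂ H {x | b ≤ x.re - x.im ∧ x.re - x.im ≤ c})
    (hb : Integrable fun u => H (obliqueLine b u)) (hc : Integrable fun u => H (obliqueLine c u))
    (hdecay : ∀ x : ℂ, b ≤ x.re - x.im → x.re - x.im ≤ c → T ≤ |x.im| →
      ‖H x‖ ≤ C * Real.exp (-(2 * Real.pi * (x.re * x.im)))) :
    ∫ u, H (obliqueLine b u) = ∫ u, H (obliqueLine c u) := by
  have h2 : √2 * √2 = 2 := Real.mul_self_sqrt zero_le_two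
  have h1 : 1 ≤ √2 := Real.one_le_sqrt.2 one_le_two
  have h3 : √2 ≤ 2 := by nlinarith
  -- Rotation by `π / 4` makes the strip horizontal. Since `re - im` becomes `-√2 * im z`, the line
  -- through `c` is the lower edge.
  set K : ℂ → ℂ := fun z => H (cexp (Real.pi * I / 4) * z) with hK
  set y₁ : ℝ := -(c * (√2 / 2)) with hy₁
  set y₂ : ℝ := -(b * (√2 / 2)) with hy₂
  have hy : y₁ ≤ y₂ := by rw [hy₁, hy₂]; nlinarith
  have key : ∀ z : ℂ, y₁ ≤ z.im → z.im ≤ y₂ →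
      b ≤ (cexp (Real.pi * I / 4) * z).re - (cexp (Real.pi * I / 4) * z).im ∧
      (cexp (Real.pi * I / 4) * z).re - (cexp (Real.pi * I / 4) * z).im ≤ c := by
    intro z hz1 hz2
    have m1 := mul_le_mul_of_nonneg_right hz1 (Real.sqrt_nonneg 2)
    have m2 := mul_le_mul_of_nonneg_right hz2 (Real.sqrt_nonneg 2)
    rw [show y₁ * √2 = -c by rw [hy₁]; linear_combination -c / 2 * h2] at m1
    rw [show y₂ * √2 = -b by rw [hy₂]; linear_combination -b / 2 * h2] at m2
    rw [exp_pi_I_div_four_mul_re, exp_pi_I_div_four_mul_im]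
    constructor <;> linarith
  have hKline : ∀ d : ℝ, (fun u : ℝ => K (u + (-(d * (√2 / 2)) : ℝ) * I)) =
      fun u => H (obliqueLine d (u - d * (√2 / 2))) := fun d => funext fun u =>
    congrArg H (exp_pi_I_div_four_mul_eq_obliqueLine d u)
  have hrect : ∀ R : ℝ,
      (∫ x in (-R)..R, K (x + y₁ * I)) - (∫ x in (-R)..R, K (x + y₂ * I)) =
        I * (∫ y in y₁..y₂, K ((-R : ℝ) + y * I)) - I * ∫ y in y₁..y₂, K (R + y * I) := by
    intro R
    have := Complex.integral_boundary_rect_eq_zero_of_differentiableOn K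
      ((-R : ℝ) + y₁ * I) (R + y₂ * I) ?_
    · simp only [add_re, ofReal_re, mul_re, ofReal_im, I_re, I_im, add_im, mul_im, smul_eq_mul,
        mul_zero, mul_one, sub_zero, add_zero, zero_add] at this
      linear_combination this
    · refine hd.comp (by fun_prop) ?_
      intro z hz
      have hz2 := hz.2
      simp only [add_im, mul_im, ofReal_re, ofReal_im, I_re, I_im, mul_zero, mul_one, zero_add,
        add_zero, Set.uIcc_of_le hy] at hz2
      exact key z hz2.1 hz2.2
  set M := |b| + |c| with hM
  have hbM : |b| ≤ M := le_add_of_nonneg_right (abs_nonneg _)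
  have hcM : |c| ≤ M := le_add_of_nonneg_left (abs_nonneg _)
  have hM0 : 0 ≤ M := (abs_nonneg _).trans hbM
  -- After rotation `im = (R + y) * √2 / 2`; as `|y| ≤ M` and `√2 / 2 ≥ 1/2`, this choice forces
  -- `|im| ≥ T`. The decay there is `exp (-π (R² - y²))`.
  have hside : ∀ R : ℝ, M + 2 * |T| ≤ |R| →
      ‖∫ y in y₁..y₂, K (R + y * I)‖ ≤
        |C| * Real.exp (Real.pi * M ^ 2) * |y₂ - y₁| * Real.exp (-Real.pi * R ^ 2) := by
    intro R hR
    refine (intervalIntegral.norm_integral_le_of_norm_le_const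
      (C := |C| * Real.exp (Real.pi * M ^ 2) * Real.exp (-Real.pi * R ^ 2)) ?_).trans
      (le_of_eq (by ring))
    intro y hy'
    rw [Set.uIoc_of_le hy] at hy'
    set z : ℂ := R + y * I with hz
    have hzre : z.re = R := by simp [hz]
    have hzim : z.im = y := by simp [hz]
    obtain ⟨k1, k2⟩ := key z (by rw [hzim]; exact hy'.1.le) (by rw [hzim]; exact hy'.2)
    have hyM : |y| ≤ M := by
      rw [abs_le] at hbM hcM ⊢
      constructor <;> nlinarith [hy'.1, hy'.2]
    have him : T ≤ |(cexp (Real.pi * I / 4) * z).im| := by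
      rw [exp_pi_I_div_four_mul_im, hzre, hzim, abs_mul, abs_of_nonneg (by positivity : 0 ≤ √2 / 2)]
      have := abs_sub_abs_le_abs_sub R (-y)
      rw [abs_neg, sub_neg_eq_add] at this
      nlinarith [le_abs_self T, abs_nonneg T]
    refine (hdecay _ k1 k2 him).trans ?_
    rw [mul_assoc |C|, ← Real.exp_add]
    refine mul_le_mul (le_abs_self _) (Real.exp_le_exp.2 ?_) (Real.exp_nonneg _) (abs_nonneg _)
    rw [exp_pi_I_div_four_mul_re, exp_pi_I_div_four_mul_im, hzre, hzim]
    have hyM2 : y ^ 2 ≤ M ^ 2 := sq_le_sq.2 (by rwa [abs_of_nonneg hM0])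
    have : 2 * Real.pi * ((R - y) * (√2 / 2) * ((R + y) * (√2 / 2))) =
        Real.pi * (R ^ 2 - y ^ 2) := by
      linear_combination Real.pi * (R ^ 2 - y ^ 2) / 2 * h2
    rw [this]
    nlinarith [Real.pi_pos]
  have hexp : Tendsto (fun R : ℝ => |C| * Real.exp (Real.pi * M ^ 2) * |y₂ - y₁| *
      Real.exp (-Real.pi * R ^ 2)) atTop (𝓝 0) := by
    have : Tendsto (fun R : ℝ => Real.exp (-Real.pi * R ^ 2)) atTop (𝓝 0) :=
      Real.tendsto_exp_atBot.comp
        ((tendsto_pow_atTop two_ne_zero).const_mul_atTop_of_neg (neg_lt_zero.2 Real.pi_pos))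
    simpa using this.const_mul (|C| * Real.exp (Real.pi * M ^ 2) * |y₂ - y₁|)
  have hright : Tendsto (fun R : ℝ => ∫ y in y₁..y₂, K (R + y * I)) atTop (𝓝 0) := by
    refine squeeze_zero_norm' ?_ hexp
    filter_upwards [eventually_ge_atTop (M + 2 * |T|)] with R hR
    exact hside R (hR.trans (le_abs_self R))
  have hleft : Tendsto (fun R : ℝ => ∫ y in y₁..y₂, K ((-R : ℝ) + y * I)) atTop (𝓝 0) := by
    refine squeeze_zero_norm' ?_ hexp
    filter_upwards [eventually_ge_atTop (M + 2 * |T|)] with R hR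
    have := hside (-R) (by rw [abs_neg]; exact hR.trans (le_abs_self R))
    rwa [neg_sq] at this
  have hlim (d : ℝ) (h : Integrable fun u => H (obliqueLine d u)) :
      Tendsto (fun R : ℝ => ∫ x in (-R)..R, K (x + (-(d * (√2 / 2)) : ℝ) * I)) atTop
        (𝓝 (∫ u, H (obliqueLine d u))) := by
    rw [hKline d, ← integral_sub_right_eq_self _ (d * (√2 / 2))]
    exact intervalIntegral_tendsto_integral (h.comp_sub_right _) tendsto_neg_atTop_atBot tendsto_id
  have l1 := (hlim c hc).sub (hlim b hb)
  have l2 := (hleft.const_mul I).sub (hright.const_mul I)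
  rw [mul_zero, sub_zero] at l2
  have := tendsto_nhds_unique (l1.congr hrect) l2
  exact (sub_eq_zero.1 this).symm

/-! ### Kernel bounds and integrability. -/

/-- The kernel `exp (π i x²) / (exp (π i x) - exp (-π i x))`. -/
noncomputable def auxKernel (x : ℂ) : ℂ := cexp (Real.pi * I * x ^ 2) / auxDenom x

theorem auxIntegrand_eq (s x : ℂ) : auxIntegrand s x = x ^ (-s) * auxKernel x := by
  rw [auxIntegrand, auxKernel, auxDenom, mul_div_assoc]

theorem norm_auxKernel_le {x : ℂ} (hx : 2 ≤ ‖auxDenom x‖) :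
    ‖auxKernel x‖ ≤ Real.exp (-(2 * Real.pi * (x.re * x.im))) := by
  rw [auxKernel, norm_div, norm_exp_pi_I_mul_sq]
  exact div_le_self (Real.exp_nonneg _) (one_le_two.trans hx)

theorem mem_slitPlane_of_im_lt_re {x : ℂ} (hx : 0 < x.re - x.im) : x ∈ slitPlane := by
  rw [mem_slitPlane_iff]
  by_contra! h
  rw [h.2] at hx
  linarith [h.1]

theorem quarter_le_norm {x : ℂ} (hx : 1 / 2 ≤ x.re - x.im) : 1 / 4 ≤ ‖x‖ := by
  linarith [le_abs_self x.re, neg_le_abs x.im, abs_re_le_norm x, abs_im_le_norm x]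

theorem norm_cpow_neg_le {σ : ℝ} (hσ : 0 ≤ σ) (t : ℝ) {x : ℂ} (hx : 1 / 2 ≤ x.re - x.im) :
    ‖x ^ (-((σ : ℂ) + t * I))‖ ≤ (1 / 4 : ℝ) ^ (-σ) * Real.exp (|t| * Real.pi) := by
  have h := quarter_le_norm hx
  have hx0 : x ≠ 0 := norm_pos_iff.1 (by linarith)
  rw [norm_cpow_neg hx0]
  refine mul_le_mul (Real.rpow_le_rpow_of_nonpos (by norm_num) h (by linarith))
    (Real.exp_le_exp.2 ?_) (Real.exp_nonneg _) (by positivity)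
  calc t * arg x ≤ |t * arg x| := le_abs_self _
    _ = |t| * |arg x| := abs_mul _ _
    _ ≤ |t| * Real.pi := by gcongr; exact abs_arg_le_pi x

theorem obliqueLine_re_sub_im (b u : ℝ) : (obliqueLine b u).re - (obliqueLine b u).im = b := by
  rw [obliqueLine_re, obliqueLine_im]; ring

theorem obliqueLine_re_mul_im (b u : ℝ) :
    2 * Real.pi * ((obliqueLine b u).re * (obliqueLine b u).im) =
      Real.pi * (u + b * (√2 / 2)) ^ 2 - Real.pi * b ^ 2 / 2 := by
  have h2 : √2 * √2 = 2 := Real.mul_self_sqrt zero_le_two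
  rw [obliqueLine_re, obliqueLine_im]
  linear_combination Real.pi * (u ^ 2 / 2 - b ^ 2 / 4) * h2

theorem integrable_exp_neg_pi_mul_sq : Integrable fun u : ℝ => Real.exp (-Real.pi * u ^ 2) :=
  integrable_exp_neg_mul_sq Real.pi_pos

theorem auxDenom_obliqueLine_ne_zero (k : ℕ) (u : ℝ) :
    auxDenom (obliqueLine (k + 1 / 2) u) ≠ 0 :=
  norm_pos_iff.1 (two_pos.trans_le (two_le_norm_auxDenom_obliqueLine k u))

theorem differentiable_auxDenom : Differentiable ℂ auxDenom :=
  fun x => (hasDerivAt_auxDenom x).differentiableAt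

theorem integrable_mul_auxKernel {p : ℂ → ℂ} {B : ℝ}
    (hp : ContinuousOn p {x | 1 / 2 ≤ x.re - x.im})
    (hB : ∀ x : ℂ, 1 / 2 ≤ x.re - x.im → ‖p x‖ ≤ B) (k : ℕ) :
    Integrable fun u => p (obliqueLine (k + 1 / 2) u) * auxKernel (obliqueLine (k + 1 / 2) u) := by
  set b : ℝ := k + 1 / 2 with hb
  have hmem (u : ℝ) : 1 / 2 ≤ (obliqueLine b u).re - (obliqueLine b u).im := by
    rw [obliqueLine_re_sub_im, hb]
    linarith [(Nat.cast_nonneg k : (0 : ℝ) ≤ k)]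
  have hg : Integrable fun u : ℝ => B * (Real.exp (-Real.pi * (u + b * (√2 / 2)) ^ 2) *
      Real.exp (Real.pi * b ^ 2 / 2)) :=
    ((integrable_exp_neg_pi_mul_sq.comp_add_right (b * (√2 / 2))).mul_const _).const_mul _
  refine hg.mono' ?_ (Eventually.of_forall fun u => ?_)
  · refine Continuous.aestronglyMeasurable ?_
    have h1 : Continuous fun u => p (obliqueLine b u) :=
      hp.comp_continuous (continuous_obliqueLine b) hmem
    have h2 : Continuous fun u => auxKernel (obliqueLine b u) := by
      have := continuous_obliqueLine b
      refine Continuous.div (by fun_prop) (differentiable_auxDenom.continuous.comp this)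
        (auxDenom_obliqueLine_ne_zero k)
    exact h1.mul h2
  · rw [norm_mul]
    refine mul_le_mul (hB _ (hmem u)) ?_ (norm_nonneg _) ((norm_nonneg _).trans (hB _ (hmem u)))
    refine (norm_auxKernel_le (two_le_norm_auxDenom_obliqueLine k u)).trans (le_of_eq ?_)
    rw [obliqueLine_re_mul_im, ← Real.exp_add]
    congr 1
    ring

theorem integrable_auxKernel (k : ℕ) :
    Integrable fun u => auxKernel (obliqueLine (k + 1 / 2) u) := by
  simpa using integrable_mul_auxKernel (p := fun _ => 1) (B := 1) continuousOn_const (by simp) k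

theorem differentiableOn_cpow_neg (s : ℂ) :
    DifferentiableOn ℂ (fun x : ℂ => x ^ (-s)) {x | 0 < x.re - x.im} := fun x hx =>
  ((hasDerivAt_id x).cpow_const
    (mem_slitPlane_of_im_lt_re hx)).differentiableAt.differentiableWithinAt

theorem integrable_auxIntegrand {σ : ℝ} (hσ : 0 ≤ σ) (t : ℝ) (k : ℕ) :
    Integrable fun u => auxIntegrand (σ + t * I) (obliqueLine (k + 1 / 2) u) := by
  simp only [auxIntegrand_eq]
  refine integrable_mul_auxKernel ?_ (fun x hx => norm_cpow_neg_le hσ t hx) k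
  refine (differentiableOn_cpow_neg _).continuousOn.mono fun x (hx : 1 / 2 ≤ x.re - x.im) => ?_
  exact one_half_pos.trans_le hx

/-! ### Crossing the poles. -/

/-- The numerator picks up `-exp (2π i x)` and the denominator a sign, so the difference has the
factor `exp (2π i x) - 1`, which cancels the denominator. The residue of the kernel thus reduces to
a Gaussian integral. -/
theorem auxKernel_add_one {x : ℂ} (hx : auxDenom x ≠ 0) :
    auxKernel (x + 1) - auxKernel x = cexp (Real.pi * I * x ^ 2 + Real.pi * I * x) := by
  have h : cexp (Real.pi * I * (x + 1) ^ 2) =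
      -(cexp (Real.pi * I * x ^ 2) * cexp (Real.pi * I * x) * cexp (Real.pi * I * x)) := by
    rw [← Complex.exp_add, ← Complex.exp_add,
      show Real.pi * I * (x + 1) ^ 2 =
        (Real.pi * I * x ^ 2 + Real.pi * I * x + Real.pi * I * x) + Real.pi * I by ring,
      Complex.exp_add _ (Real.pi * I), exp_pi_mul_I]
    ring
  have h1 : cexp (Real.pi * I * x) * cexp (-(Real.pi * I * x)) = 1 := by
    rw [← Complex.exp_add]; simp
  rw [auxKernel, auxKernel, auxDenom_add_one, h, neg_div_neg_eq, ← sub_div, div_eq_iff hx,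
    Complex.exp_add, auxDenom]
  linear_combination cexp (Real.pi * I * x ^ 2) * h1

theorem obliqueLine_add_one (b u : ℝ) : obliqueLine (b + 1) u = obliqueLine b u + 1 := by
  simp only [obliqueLine]; push_cast; ring

theorem integral_exp_quadratic_obliqueLine (b : ℝ) :
    (∫ u, cexp (Real.pi * I * obliqueLine b u ^ 2 + Real.pi * I * obliqueLine b u)) *
      cexp (Real.pi * I / 4) = 1 := by
  have hpi : (Real.pi : ℂ) ≠ 0 := ofReal_ne_zero.2 Real.pi_ne_zero
  have he := exp_pi_I_div_four_sq
  set e := cexp (Real.pi * I / 4) with hee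
  have h (u : ℝ) : Real.pi * I * obliqueLine b u ^ 2 + Real.pi * I * obliqueLine b u =
      (-Real.pi : ℂ) * u ^ 2 + (Real.pi * I * e * (2 * b + 1)) * u + Real.pi * I * (b ^ 2 + b) := by
    rw [obliqueLine, ← hee]
    linear_combination Real.pi * I * u ^ 2 * he + Real.pi * u ^ 2 * I_sq
  simp only [h]
  rw [integral_cexp_quadratic (by simpa using Real.pi_pos), neg_neg, div_self hpi, one_cpow, one_mul,
    hee, ← Complex.exp_add, ← hee]
  rw [show (Real.pi * I * (b ^ 2 + b) - (Real.pi * I * e * (2 * b + 1)) ^ 2 / (4 * -Real.pi) +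
      Real.pi * I / 4 : ℂ) = 0 by
    field_simp
    linear_combination
      Real.pi * (2 * b + 1) ^ 2 * I ^ 2 * he + Real.pi * (2 * b + 1) ^ 2 * I * I_sq]
  exact Complex.exp_zero

theorem integral_auxKernel_succ (k : ℕ) :
    ((∫ u, auxKernel (obliqueLine ((k + 1 : ℕ) + 1 / 2) u)) -
      ∫ u, auxKernel (obliqueLine (k + 1 / 2) u)) * cexp (Real.pi * I / 4) = 1 := by
  rw [← integral_sub (integrable_auxKernel _) (integrable_auxKernel _),
    ← integral_exp_quadratic_obliqueLine (k + 1 / 2)]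
  congr 2
  funext u
  rw [← auxKernel_add_one (auxDenom_obliqueLine_ne_zero k u), ← obliqueLine_add_one]
  congr 3
  push_cast; ring

/-- The removable singularity at `n` of `(x ^ (-s) - n ^ (-s)) * auxKernel x`. -/
theorem exists_differentiableOn_eq_sub_mul_auxKernel (s : ℂ) (n : ℕ) (hn : 0 < n) :
    ∃ H : ℂ → ℂ, DifferentiableOn ℂ H {x | (n : ℝ) - 1 < x.re - x.im ∧ x.re - x.im < n + 1} ∧
      ∀ x, auxDenom x ≠ 0 → H x = (x ^ (-s) - (n : ℂ) ^ (-s)) * auxKernel x := by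
  set S : Set ℂ := {x | (n : ℝ) - 1 < x.re - x.im ∧ x.re - x.im < n + 1} with hS
  set A : ℂ → ℂ := fun x => (x ^ (-s) - (n : ℂ) ^ (-s)) * cexp (Real.pi * I * x ^ 2) with hA
  have hn1 : (1 : ℝ) ≤ n := by exact_mod_cast hn
  have hSo : IsOpen S := by
    have hc : Continuous fun x : ℂ => x.re - x.im := by fun_prop
    exact (isOpen_lt continuous_const hc).inter (isOpen_lt hc continuous_const)
  have hSn : S ∈ 𝓝 (n : ℂ) := hSo.mem_nhds (by simp [hS])
  have hAd : DifferentiableOn ℂ A S := by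
    refine DifferentiableOn.mul (((differentiableOn_cpow_neg s).mono ?_).sub_const _)
      (by fun_prop)
    intro x hx
    exact lt_of_le_of_lt (by linarith) hx.1
  have hAn : A n = 0 := by simp [hA]
  -- Numerator and denominator both vanish at `n`, so the quotient of their divided differences
  -- fills in the value. The denominator has no other zero in the strip, `n` being its only integer.
  refine ⟨fun x => dslope A n x / dslope auxDenom n x, ?_, ?_⟩
  · refine ((Complex.differentiableOn_dslope hSn).2 hAd).div
      ((Complex.differentiableOn_dslope hSn).2 differentiable_auxDenom.differentiableOn) ?_
    intro x hx
    by_cases hxn : x = n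
    · rw [hxn, dslope_same]
      exact deriv_auxDenom_natCast_ne_zero n
    · rw [dslope_of_ne _ hxn, slope_def_field, auxDenom_natCast, sub_zero]
      refine div_ne_zero (fun h0 => hxn ?_) (sub_ne_zero.2 hxn)
      obtain ⟨m, rfl⟩ := exists_int_of_auxDenom_eq_zero h0
      have h1 : (n : ℝ) - 1 < m := by simpa using hx.1
      have h2 : (m : ℝ) < n + 1 := by simpa using hx.2
      have h3 : (n : ℤ) - 1 < m := by exact_mod_cast h1
      have h4 : m < (n : ℤ) + 1 := by exact_mod_cast h2
      have : m = n := by omega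
      rw [this]; simp
  · intro x hx
    have hxn : x ≠ n := by
      rintro rfl
      exact hx (auxDenom_natCast n)
    simp only [dslope_of_ne _ hxn, slope_def_field, auxDenom_natCast, hAn, sub_zero]
    rw [div_div_div_cancel_right₀ (sub_ne_zero.2 hxn), auxKernel, mul_div_assoc]

/-- Subtracting `q * auxKernel` removes the pole at `k + 1`, so the difference has equal integrals
on both lines; the jump is `q` times that of the kernel, which is `1`. -/
theorem integral_auxIntegrand_succ {σ : ℝ} (hσ : 0 ≤ σ) (t : ℝ) (k : ℕ) :
    ((∫ u, auxIntegrand (σ + t * I) (obliqueLine ((k + 1 : ℕ) + 1 / 2) u)) -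
      ∫ u, auxIntegrand (σ + t * I) (obliqueLine (k + 1 / 2) u)) * cexp (Real.pi * I / 4) =
        ((k + 1 : ℕ) : ℂ) ^ (-((σ : ℂ) + t * I)) := by
  obtain ⟨H, hd, hH⟩ :=
    exists_differentiableOn_eq_sub_mul_auxKernel (σ + t * I) (k + 1) k.succ_pos
  set q := ((k + 1 : ℕ) : ℂ) ^ (-((σ : ℂ) + t * I)) with hq
  have hline (j : ℕ) : (fun u => H (obliqueLine (j + 1 / 2) u)) = fun u =>
      auxIntegrand (σ + t * I) (obliqueLine (j + 1 / 2) u) -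
        q * auxKernel (obliqueLine (j + 1 / 2) u) := by
    funext u
    rw [hH _ (auxDenom_obliqueLine_ne_zero j u), auxIntegrand_eq, sub_mul]
  have hint (j : ℕ) : Integrable fun u => H (obliqueLine (j + 1 / 2) u) := by
    rw [hline]
    exact (integrable_auxIntegrand hσ t j).sub ((integrable_auxKernel j).const_mul q)
  have hval (j : ℕ) : ∫ u, H (obliqueLine (j + 1 / 2) u) =
      (∫ u, auxIntegrand (σ + t * I) (obliqueLine (j + 1 / 2) u)) -
        q * ∫ u, auxKernel (obliqueLine (j + 1 / 2) u) := by
    rw [hline, integral_sub (integrable_auxIntegrand hσ t j)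
      ((integrable_auxKernel j).const_mul q), integral_const_mul]
  have hk0 : (0 : ℝ) ≤ k := Nat.cast_nonneg k
  set B := (1 / 4 : ℝ) ^ (-σ) * Real.exp (|t| * Real.pi) with hB
  have hqB : ‖q‖ ≤ B := by
    refine norm_cpow_neg_le hσ t ?_
    simp
    linarith
  have hshift := integral_obliqueLine_eq (H := H) (b := k + 1 / 2) (c := (k + 1 : ℕ) + 1 / 2)
    (C := 2 * B) (T := 1) (by push_cast; linarith) ?_ (hint k) (hint (k + 1)) ?_
  · rw [hval, hval] at hshift
    linear_combination q * integral_auxKernel_succ k - cexp (Real.pi * I / 4) * hshift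
  · refine hd.mono fun x hx => ?_
    have h1 := hx.1
    have h2 := hx.2
    push_cast at h2
    constructor <;> push_cast <;> linarith
  · intro x h1 _ him
    have hD := two_le_norm_auxDenom_of_im him
    rw [hH x (norm_pos_iff.1 (two_pos.trans_le hD)), norm_mul]
    have hxB : ‖x ^ (-((σ : ℂ) + t * I))‖ ≤ B := norm_cpow_neg_le hσ t (by linarith)
    refine mul_le_mul ?_ (norm_auxKernel_le hD) (norm_nonneg _) (by positivity)
    exact (norm_sub_le _ _).trans (by linarith)

/-- Moving the path across the poles `1, …, N` splits off a partial sum of the zeta series. -/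
theorem riemannAux_eq_sum_sub_integral {σ : ℝ} (hσ : 0 ≤ σ) (t : ℝ) (N : ℕ) :
    riemannAux (σ + t * I) = ∑ k ∈ Finset.range N, ((k + 1 : ℕ) : ℂ) ^ (-((σ : ℂ) + t * I)) -
      (∫ u, auxIntegrand (σ + t * I) (obliqueLine (N + 1 / 2) u)) * cexp (Real.pi * I / 4) := by
  induction N with
  | zero =>
    rw [riemannAux, integral_mul_const]
    simp [auxLine, obliqueLine]
  | succ N ih =>
    rw [ih, Finset.sum_range_succ, ← integral_auxIntegrand_succ hσ t N]
    ring

theorem norm_riemannAux_le {σ : ℝ} (hσ : 0 ≤ σ) (t : ℝ) (N : ℕ) :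
    ‖riemannAux (σ + t * I)‖ ≤
      N + ∫ u, ‖auxIntegrand (σ + t * I) (obliqueLine (N + 1 / 2) u)‖ := by
  rw [riemannAux_eq_sum_sub_integral hσ t N]
  refine (norm_sub_le _ _).trans (add_le_add ?_ ?_)
  · refine (norm_sum_le _ _).trans ?_
    calc ∑ k ∈ Finset.range N, ‖((k + 1 : ℕ) : ℂ) ^ (-((σ : ℂ) + t * I))‖
        ≤ ∑ k ∈ Finset.range N, (1 : ℝ) := Finset.sum_le_sum fun k _ => by
          rw [norm_natCast_cpow_of_pos k.succ_pos]
          refine Real.rpow_le_one_of_one_le_of_nonpos ?_ (by simpa using hσ)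
          exact_mod_cast k.succ_pos
      _ = N := by simp
  · rw [norm_mul, norm_exp_pi_I_div_four, mul_one]
    exact norm_integral_le_integral_norm _

/-! ### Gaussian majorant on the shifted line. -/

/-- For `α ≥ 0` this follows from `α ≤ tan α`; for `α ≤ 0`, from `α ≤ sin α` and `cos α - sin α ≥
1`. At `α = arg x` it bounds `arg x` on a line by a linear function of `u`. -/
theorem mul_cos_sub_sin_le_sin {α : ℝ} (h : |α| ≤ Real.pi / 2) :
    α * (Real.cos α - Real.sin α) ≤ Real.sin α := by
  obtain ⟨h1, h2⟩ := abs_le.1 h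
  rcases le_total 0 α with h0 | h0
  · have hs : 0 ≤ Real.sin α := Real.sin_nonneg_of_nonneg_of_le_pi h0 (by linarith [Real.pi_pos])
    have hc : α * Real.cos α ≤ Real.sin α := by
      rcases h2.lt_or_eq with h2 | h2
      · have hc : 0 < Real.cos α := Real.cos_pos_of_mem_Ioo ⟨by linarith, h2⟩
        have := Real.le_tan h0 h2
        rwa [Real.tan_eq_sin_div_cos, le_div_iff₀ hc] at this
      · rw [h2]; simp
    nlinarith
  · have hs : Real.sin α ≤ 0 :=
      Real.sin_nonpos_of_nonpos_of_neg_pi_le h0 (by linarith [Real.pi_pos])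
    have hc : 0 ≤ Real.cos α := Real.cos_nonneg_of_mem_Icc ⟨by linarith, h2⟩
    have h3 : α ≤ Real.sin α := by
      have := Real.sin_le (neg_nonneg.2 h0)
      rw [Real.sin_neg] at this
      linarith
    have h4 : 1 ≤ Real.cos α - Real.sin α := by
      nlinarith [Real.sin_sq_add_cos_sq α, Real.cos_le_one α, Real.neg_one_le_sin α]
    nlinarith

theorem arg_mul_re_sub_im_le {x : ℂ} (hx : 0 ≤ x.re) : arg x * (x.re - x.im) ≤ x.im := by
  have h := mul_le_mul_of_nonneg_left (mul_cos_sub_sin_le_sin (abs_arg_le_pi_div_two_iff.2 hx))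
    (norm_nonneg x)
  rw [norm_mul_sin_arg] at h
  linear_combination h - arg x * norm_mul_cos_arg x + arg x * norm_mul_sin_arg x

theorem arg_le_neg_pi_div_two {x : ℂ} (hre : x.re < 0) (him : x.im < 0) :
    arg x ≤ -(Real.pi / 2) := by
  have h1 : ¬ |arg x| ≤ Real.pi / 2 := fun h => hre.not_ge (abs_arg_le_pi_div_two_iff.1 h)
  rw [abs_of_neg (arg_neg_iff.2 him)] at h1
  linarith

/-- With `κ = (a² - b²) / b` and `re = b + im`, the bound `arg ≤ im / b` gives `2π * im * (κ - im)`;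
complete the square. -/
theorem exponent_le_of_re_nonneg {a b u : ℝ} (hb : 0 < b) (hx : 0 ≤ (obliqueLine b u).re) :
    2 * Real.pi * a ^ 2 * arg (obliqueLine b u) -
        2 * Real.pi * ((obliqueLine b u).re * (obliqueLine b u).im) ≤
      Real.pi * ((a ^ 2 - b ^ 2) / b) ^ 2 / 2 +
        -Real.pi * (u - (a ^ 2 - b ^ 2) / b * (√2 / 2)) ^ 2 := by
  have h2 : √2 * √2 = 2 := Real.mul_self_sqrt zero_le_two
  have h := arg_mul_re_sub_im_le hx
  rw [obliqueLine_re_sub_im, ← le_div_iff₀ hb] at h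
  have h' := mul_le_mul_of_nonneg_left h (by positivity : 0 ≤ 2 * Real.pi * a ^ 2)
  refine (sub_le_sub_right h' _).trans (le_of_eq ?_)
  rw [obliqueLine_re, obliqueLine_im]
  have hκ : a ^ 2 / b = (a ^ 2 - b ^ 2) / b + b := by field_simp; ring
  rw [mul_assoc (2 * Real.pi), ← mul_div_assoc, mul_div_right_comm, hκ]
  generalize (a ^ 2 - b ^ 2) / b = κ
  linear_combination (-Real.pi * u ^ 2 / 2 + Real.pi * κ ^ 2 / 4) * h2

/-- Here `im < re < 0`, so `arg ≤ -π / 2` and `re * im ≥ re²`. -/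
theorem exponent_le_of_re_neg {a b u : ℝ} (hb : 0 < b) (hx : (obliqueLine b u).re < 0) :
    2 * Real.pi * a ^ 2 * arg (obliqueLine b u) -
        2 * Real.pi * ((obliqueLine b u).re * (obliqueLine b u).im) ≤
      -(Real.pi ^ 2 * a ^ 2) + -Real.pi * (u + b * √2) ^ 2 := by
  have h2 : √2 * √2 = 2 := Real.mul_self_sqrt zero_le_two
  have hsub := obliqueLine_re_sub_im b u
  have h := arg_le_neg_pi_div_two hx (by linarith)
  have h' := mul_le_mul_of_nonneg_left h (by positivity : 0 ≤ 2 * Real.pi * a ^ 2)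
  have h3 : (u + b * √2) ^ 2 = 2 * (obliqueLine b u).re ^ 2 := by
    rw [obliqueLine_re]
    linear_combination (b ^ 2 - u ^ 2 / 2) * h2
  have h4 : (obliqueLine b u).re ^ 2 ≤ (obliqueLine b u).re * (obliqueLine b u).im := by nlinarith
  have h5 := mul_le_mul_of_nonneg_left h4 (by positivity : 0 ≤ 2 * Real.pi)
  rw [h3]
  linarith

theorem integral_exp_neg_pi_mul_sq : ∫ u : ℝ, Real.exp (-Real.pi * u ^ 2) = 1 := by
  rw [integral_gaussian, div_self Real.pi_ne_zero, Real.sqrt_one]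

theorem norm_auxIntegrand_obliqueLine_le {σ a : ℝ} (hσ : 0 ≤ σ) {k : ℕ} (hk : 2 ≤ k) (u : ℝ) :
    ‖auxIntegrand (σ + (2 * Real.pi * a ^ 2 : ℝ) * I) (obliqueLine (k + 1 / 2) u)‖ ≤
      (Real.exp (Real.pi * ((a ^ 2 - (k + 1 / 2) ^ 2) / (k + 1 / 2)) ^ 2 / 2) *
          Real.exp (-Real.pi *
            (u - (a ^ 2 - (k + 1 / 2) ^ 2) / (k + 1 / 2) * (√2 / 2)) ^ 2) +
        Real.exp (-(Real.pi ^ 2 * a ^ 2)) *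
          Real.exp (-Real.pi * (u + (k + 1 / 2) * √2) ^ 2)) / 2 := by
  have hD := two_le_norm_auxDenom_obliqueLine k u
  have hk2 : (2 : ℝ) ≤ k := by exact_mod_cast hk
  set b : ℝ := k + 1 / 2 with hb
  have hb0 : 0 < b := by positivity
  have hnorm : 1 ≤ ‖obliqueLine b u‖ := by
    linarith [le_abs_self (obliqueLine b u).re, neg_le_abs (obliqueLine b u).im,
      abs_re_le_norm (obliqueLine b u), abs_im_le_norm (obliqueLine b u),
      obliqueLine_re_sub_im b u]
  rw [norm_auxIntegrand (norm_pos_iff.1 (one_pos.trans_le hnorm))]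
  refine div_le_div₀ (by positivity) ?_ two_pos hD
  refine (mul_le_of_le_one_left (Real.exp_nonneg _)
    (Real.rpow_le_one_of_one_le_of_nonpos hnorm (by linarith))).trans ?_
  rw [← Real.exp_add, ← Real.exp_add]
  rcases le_or_gt 0 (obliqueLine b u).re with hx | hx
  · exact (Real.exp_le_exp.2 (exponent_le_of_re_nonneg hb0 hx)).trans
      (le_add_of_nonneg_right (Real.exp_nonneg _))
  · exact (Real.exp_le_exp.2 (exponent_le_of_re_neg hb0 hx)).trans
      (le_add_of_nonneg_left (Real.exp_nonneg _))

theorem integral_norm_auxIntegrand_le {σ a : ℝ} (hσ : 0 ≤ σ) {k : ℕ} (hk : 2 ≤ k) :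
    ∫ u, ‖auxIntegrand (σ + (2 * Real.pi * a ^ 2 : ℝ) * I) (obliqueLine (k + 1 / 2) u)‖ ≤
      (Real.exp (Real.pi * ((a ^ 2 - (k + 1 / 2) ^ 2) / (k + 1 / 2)) ^ 2 / 2) +
        Real.exp (-(Real.pi ^ 2 * a ^ 2))) / 2 := by
  have i1 := (integrable_exp_neg_pi_mul_sq.comp_sub_right
    ((a ^ 2 - (k + 1 / 2) ^ 2) / (k + 1 / 2) * (√2 / 2))).const_mul
      (Real.exp (Real.pi * ((a ^ 2 - (k + 1 / 2) ^ 2) / (k + 1 / 2)) ^ 2 / 2))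
  have i2 := (integrable_exp_neg_pi_mul_sq.comp_add_right
    ((k + 1 / 2) * √2)).const_mul (Real.exp (-(Real.pi ^ 2 * a ^ 2)))
  refine (integral_mono (integrable_auxIntegrand hσ _ k).norm ((i1.add i2).div_const 2)
    (norm_auxIntegrand_obliqueLine_le hσ hk)).trans (le_of_eq ?_)
  simp only [Pi.add_apply]
  rw [integral_div, integral_add i1 i2, integral_const_mul, integral_const_mul,
    integral_sub_right_eq_self (fun u : ℝ => Real.exp (-Real.pi * u ^ 2)),
    integral_add_right_eq_self (fun u : ℝ => Real.exp (-Real.pi * u ^ 2)),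
    integral_exp_neg_pi_mul_sq, mul_one, mul_one]

/-! ### The numerical inequality. -/

theorem exp_neg_le_inv {y : ℝ} (hy : 0 ≤ y) : Real.exp (-y) ≤ (1 + y)⁻¹ := by
  rw [Real.exp_neg]
  exact inv_anti₀ (by linarith) (by linarith [Real.add_one_le_exp y])

theorem exp_two_sub_le {y : ℝ} (hy : 0 ≤ y) : Real.exp (2 - y) ≤ 7.39 / (1 + y) := by
  have h2 : Real.exp 2 ≤ 7.39 := by
    rw [show (2 : ℝ) = 1 + 1 by norm_num, Real.exp_add]
    nlinarith [Real.exp_one_lt_d9, Real.exp_pos 1]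
  rw [sub_eq_add_neg, Real.exp_add, div_eq_mul_inv]
  exact mul_le_mul h2 (exp_neg_le_inv hy) (Real.exp_nonneg _) (by norm_num)

theorem exp_add_exp_le_of_floor {a : ℝ} {N : ℕ} (ha : 2.82 ≤ a) (hN : N ≤ a) (hN' : a < N + 1) :
    Real.exp (Real.pi * ((a ^ 2 - (N + 1 / 2) ^ 2) / (N + 1 / 2)) ^ 2 / 2) +
      Real.exp (-(Real.pi ^ 2 * a ^ 2)) ≤ 2 * (2 * a - N) := by
  have hpi3 := Real.pi_gt_three
  have hpi := Real.pi_lt_d2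
  have hN2 : 2 ≤ N := by
    have : (1 : ℝ) < N := by linarith
    exact_mod_cast this
  have hN2' : (2 : ℝ) ≤ N := by exact_mod_cast hN2
  have htail : Real.exp (-(Real.pi ^ 2 * a ^ 2)) ≤ 1 / 50 := by
    refine (exp_neg_le_inv (by positivity)).trans ?_
    rw [one_div]
    refine inv_anti₀ (by norm_num) ?_
    have h1 : 9 ≤ Real.pi ^ 2 := by nlinarith
    have h2 : 7 ≤ a ^ 2 := by nlinarith
    nlinarith
  set b : ℝ := N + 1 / 2 with hb
  have hb0 : 0 < b := by positivity
  rcases lt_or_ge a b with hab | hab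
  -- `N = 2` is excluded since `a ≥ 2.82 > 5/2`; hence the right side is at least `2a ≥ 6`.
  · have hN3 : (3 : ℝ) ≤ N := by
      have : (2 : ℝ) < N := by linarith
      have : 2 < N := by exact_mod_cast this
      exact_mod_cast this
    have hκ : ((a ^ 2 - b ^ 2) / b) ^ 2 ≤ 1 := by
      rw [sq_le_one_iff_abs_le_one, abs_le, le_div_iff₀ hb0, div_le_iff₀ hb0]
      constructor <;> nlinarith
    have hmain : Real.exp (Real.pi * ((a ^ 2 - b ^ 2) / b) ^ 2 / 2) ≤ 5.5 := by
      refine (Real.exp_le_exp.2 (by nlinarith : _ ≤ 2 - (0.4 : ℝ))).trans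
        ((exp_two_sub_le (by norm_num)).trans (by norm_num))
    linarith
  -- From `a < N + 1`, `κ ≤ 1 + 1 / (4b)`, which is `1.1` at `N = 2`. That case is the tight one: it
  -- needs `2a - 2 ≥ 3.6`, supplied by `a ≥ 2.82`.
  · have hκ : ((a ^ 2 - b ^ 2) / b) ^ 2 ≤ 1.1 ^ 2 := by
      refine pow_le_pow_left₀ (div_nonneg (by nlinarith) hb0.le) ?_ 2
      rw [div_le_iff₀ hb0]
      nlinarith
    have hmain : Real.exp (Real.pi * ((a ^ 2 - b ^ 2) / b) ^ 2 / 2) ≤ 7 := by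
      refine (Real.exp_le_exp.2 (by nlinarith : _ ≤ 2 - (0.09 : ℝ))).trans
        ((exp_two_sub_le (by norm_num)).trans (by norm_num))
    have hlow : 3.6 ≤ 2 * a - N := by
      rcases hN2.eq_or_lt with h | h
      · rw [← h]; push_cast; linarith
      · have : (3 : ℝ) ≤ N := by exact_mod_cast h
        linarith
    linarith

theorem mainTheorem3 (σ t : ℝ) (hσ : 0 < σ) (ht : 16 * Real.pi < t) :
    ‖riemannAux ((σ : ℂ) + (t : ℂ) * Complex.I)‖ ≤ 2 * Real.sqrt (t / (2 * Real.pi)) := by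
  set a := Real.sqrt (t / (2 * Real.pi)) with ha
  have hpi := Real.pi_pos
  have h8 : 8 ≤ t / (2 * Real.pi) := by rw [le_div_iff₀ (by positivity)]; linarith
  have hasq : a ^ 2 = t / (2 * Real.pi) := Real.sq_sqrt (by linarith)
  have ht2 : t = 2 * Real.pi * a ^ 2 := by rw [hasq]; field_simp
  have ha0 : 0 ≤ a := Real.sqrt_nonneg _
  have ha1 : 2.82 ≤ a := Real.le_sqrt_of_sq_le (by linarith)
  have hN := Nat.floor_le ha0
  have hN' := Nat.lt_floor_add_one a
  have hN2 : 2 ≤ ⌊a⌋₊ := Nat.le_floor (by push_cast; linarith)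
  have h1 := norm_riemannAux_le hσ.le t ⌊a⌋₊
  have h2 := integral_norm_auxIntegrand_le (a := a) hσ.le hN2
  rw [← ht2] at h2
  have h3 := exp_add_exp_le_of_floor ha1 hN hN'
  linarith
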